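/- Let $\mathbb S=\mathbb R/2\pi\mathbb Z$ with Lebesgue measure of total mass $2\pi$; all function spaces are real. For $(F,f)\in L_\infty(\mathbb S)\times\mathbb R$ and $(\Phi,\phi)\in L_\infty^*(\mathbb S)\times\mathbb R$ put \[ \langle (F,f),(\Phi,\phi)\rangle=\langle F,\Phi\rangle+2\pi f\phi , \] and regard $L_1(\mathbb S)$ as a subspace of $L_\infty^*(\mathbb S)$ via $\langle F,\Phi\rangle=\int_{\mathbb S}F\Phi\,dx$. Let \[ D_\infty=\Big\{(F,f)\in L_\infty(\mathbb S)\times\mathbb R \ \Big|\ \langle (F,f),(\Phi,\phi)\rangle\le\frac1{2\pi}\int_0^1\int_0^{2\pi}|\Phi(x)-\phi\tau|\,dx\,d\tau\ \text{ for all }(\Phi,\phi)\in L_1(\mathbb S)\times\mathbb R\Big\}, \] and let $s_{D_\infty}(\Phi,\phi)=\sup_{(F,f)\in D_\infty}\langle (F,f),(\Phi,\phi)\rangle$ be its support function on $L_\infty^*(\mathbb S)\times\mathbb R$. Let $\mathfrak X$ be the set of nonzero continuous multiplicative linear functionals $\chi:L_\infty(\mathbb S)\to\mathbb R$ with the weak$^*$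 topology, and let $\bar F(\chi)=\chi(F)$ for $F\in L_\infty(\mathbb S)$. Then for every $\Phi\in L_\infty^*(\mathbb S)$ there is exactly one finite signed regular Borel measure $\bar\Phi$ on $\mathfrak X$ with $\int_{\mathfrak X}\bar F\,d\bar\Phi=\langle F,\Phi\rangle$ for all $F\in L_\infty(\mathbb S)$. Let $\bar 1$ be the measure corresponding to the constant function $1\in L_1(\mathbb S)$. For every $(\Phi,\phi)\in L_\infty^*(\mathbb S)\times\mathbb R$ the function $\tau\mapsto\int_{\mathfrak X}|\bar\Phi-\phi\tau\bar 1|$ is integrable on $[0,1]$, and \[ s_{D_\infty}(\Phi,\phi)=\frac1{2\pi}\int_0^1\int_{\mathfrak X}\big|\bar\Phi-\phi\tau\bar 1\big|\,d\tau , \] where $\int_{\mathfrak X}|\nu|$ denotes the total variation $|\nu|(\mathfrak X)$ of a signed measure $\nu$. -/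

import Mathlib

open MeasureTheory Set
open scoped Real ENNReal

noncomputable section

namespace LimitSet

instance factTwoPiPos : Fact (0 < 2 * π) := ⟨Real.two_pi_pos⟩

/-- The circle `ℝ / 2πℤ`; its `volume` is Lebesgue measure, of total mass `2π`. -/
abbrev Circ : Type := AddCircle (2 * π)

/-- Real `L_∞` of the circle. -/
abbrev Linf : Type := Lp ℝ ∞ (volume : Measure Circ)

/-- Real `L_1` of the circle. -/
abbrev LOne : Type := Lp ℝ 1 (volume : Measure Circ)

/-- The embedding of `L_1` into the dual of `L_∞`: `Φ` acts by `F ↦ ∫ Φ F`. -/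
def ofLOne (Φ : LOne) : StrongDual ℝ Linf :=
  (ContinuousLinearMap.mul ℝ ℝ).lpPairing volume 1 ∞ Φ

theorem ofLOne_apply (Φ : LOne) (F : Linf) : ofLOne Φ F = ∫ x, Φ x * F x := by
  simp [ofLOne, ContinuousLinearMap.lpPairing_eq_integral]

/-- The constant function `1`, as a functional on `L_∞`: `F ↦ ∫ F`. -/
def oneFunctional : StrongDual ℝ Linf := ofLOne (Lp.const 1 volume (1 : ℝ))

/-- `⟨(F, f), (Φ, φ)⟩ = ⟨F, Φ⟩ + 2π f φ`. -/
def pairing (p : Linf × ℝ) (q : StrongDual ℝ Linf × ℝ) : ℝ :=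
  q.1 p.1 + 2 * π * p.2 * q.2

/-- The limit reachable set `D_∞`. -/
def limitReachableSet : Set (Linf × ℝ) :=
  {p | ∀ (Φ : LOne) (φ : ℝ),
    pairing p (ofLOne Φ, φ) ≤ 1 / (2 * π) * ∫ τ in (0 : ℝ)..1, ∫ x : Circ, |Φ x - φ * τ|}

/-- The support function of a set `D`, with values in the extended reals. -/
def supportFunction (D : Set (Linf × ℝ)) (q : StrongDual ℝ Linf × ℝ) : EReal :=
  ⨆ p ∈ D, (pairing p q : EReal)

/-- The Gelfand spectrum of `L_∞`: nonzero multiplicative continuous linear functionals.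
Here `F • G` is the pointwise product of `F` and `G`. -/
def GelfandSpectrum : Type :=
  {χ : WeakDual ℝ Linf // χ ≠ 0 ∧ ∀ F G : Linf, χ (F • G : Linf) = χ F * χ G}

namespace GelfandSpectrum

/-- The topology induced by the weak-* topology. -/
instance : TopologicalSpace GelfandSpectrum := instTopologicalSpaceSubtype

/-- The Borel σ-algebra. -/
instance : MeasurableSpace GelfandSpectrum := borel GelfandSpectrum

instance : BorelSpace GelfandSpectrum := ⟨rfl⟩

end GelfandSpectrum

/-- The Gelfand transform `F ↦ (χ ↦ χ F)`. -/
def gelfand (F : Linf) (χ : GelfandSpectrum) : ℝ := χ.1 F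

theorem continuous_gelfand (F : Linf) : Continuous (gelfand F) :=
  (WeakDual.eval_continuous F).comp continuous_subtype_val

/-- `m` is the regular signed Borel measure on the Gelfand spectrum corresponding to `Φ`:
integration of Gelfand transforms against `m` is `Φ`. -/
def IsGelfandMeasure (Φ : StrongDual ℝ Linf) (m : SignedMeasure GelfandSpectrum) : Prop :=
  m.totalVariation.Regular ∧ ∀ F : Linf, ∫ᵛ χ, gelfand F χ ∂•m = Φ F

/-- The measure corresponding to `Φ` (chosen; the theorem asserts existence and uniqueness). -/
def gelfandMeasure (Φ : StrongDual ℝ Linf) : SignedMeasure GelfandSpectrum :=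
  Classical.epsilon (IsGelfandMeasure Φ)

/-- The mass `∫_𝔛 |m|` of the total variation of a signed measure. -/
def mass (m : SignedMeasure GelfandSpectrum) : ℝ := m.totalVariation.real univ

end LimitSet

end

open LimitSet

noncomputable section

namespace LimitSet

open Filter Topology

/-! Gelfand duality identifies $L_\infty$ isometrically with $C(\mathfrak X)$, and Riesz
representation identifies functionals on $C(\mathfrak X)$ with regular signed measures, total
variation being the dual norm. Hence $|\bar\Phi-\phi\tau\bar 1|(\mathfrak X)=\|\Phi-\phi\tau\cdot
1\|$ (`mass_gelfandMeasure_sub`), which is continuous in $\tau$. What remains is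
`supportFunction_eq`, a statement about dual norms only.

Lower bound: choose near-norming elements $\sigma(\tau)$ of the unit ball for $\Phi-\phi\tau\cdot
1$, measurably in $\tau$. Averaging $\sigma$ gives a point of $D_\infty$ (`curvePoint_mem`) whose
pairing with $(\Phi,\phi)$ nearly reaches the integral.

Upper bound: $D_\infty$ is cut out by $L_1$ tests only, so a bound against all of $L_\infty^*$ needs
structure. For $(F,f)\in D_\infty$, tests with $\phi=0$ give $|u|\le 1$ for $u=2\pi F$. Put
$a=(1+u)/2\in[0,1]$ and $\omega(t)=a-|a-t|$, a 1-Lipschitz curve in $L_\infty$ from $0$ to $u$,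
formally with $\omega'=\operatorname{sign}(a-t)$. Integrating $(\Phi-\tau\phi\cdot 1)(\omega')$ by
parts (`sub_add_integral_le_integral_norm`) bounds $\Phi(u)$ plus an explicit multiple of $\phi$;
the single test $(\phi a,\phi)$ bounds $f\phi$, and the two bounds fit together exactly. -/

/-! ### Almost-everywhere calculus in $L_\infty$. -/

theorem ae_abs_le_norm (F : Linf) : ∀ᵐ x, |F x| ≤ ‖F‖ := by
  filter_upwards [ae_le_eLpNormEssSup (f := F) (μ := volume)] with x hx
  rw [Lp.norm_def, eLpNorm_exponent_top, ← Real.norm_eq_abs, ← toReal_enorm]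
  refine ENNReal.toReal_mono ?_ hx
  rw [← eLpNorm_exponent_top]
  exact Lp.eLpNorm_ne_top F

theorem norm_le_of_ae_abs_le {F : Linf} {C : ℝ} (hC : 0 ≤ C) (h : ∀ᵐ x, |F x| ≤ C) :
    ‖F‖ ≤ C := by
  rw [Lp.norm_def, eLpNorm_exponent_top]
  exact ENNReal.toReal_le_of_le_ofReal hC (eLpNormEssSup_le_of_ae_bound h)

/-- Continuous functional calculus in `L_∞`. -/
theorem exists_comp_ae_eq (F : Linf) {g : ℝ → ℝ} (hg : Continuous g) :
    ∃ G : Linf, ∀ᵐ x, G x = g (F x) := by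
  obtain ⟨C, hC⟩ := (isCompact_Icc (a := -‖F‖) (b := ‖F‖)).exists_bound_of_continuousOn
    hg.continuousOn
  have hm : MemLp (fun x => g (F x)) ∞ (volume : Measure Circ) := by
    refine memLp_top_of_bound (hg.comp_aestronglyMeasurable (Lp.aestronglyMeasurable F)) C ?_
    filter_upwards [ae_abs_le_norm F] with x hx
    exact hC _ (abs_le.mp hx)
  exact ⟨hm.toLp _, hm.coeFn_toLp⟩

/-- The constant function `1` in `L_∞`. -/
def oneLinf : Linf := Lp.const ∞ volume (1 : ℝ)

theorem oneLinf_ae : ∀ᵐ x, oneLinf x = 1 := Lp.coeFn_const ..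

theorem mul_ae (F G : Linf) : ∀ᵐ x, (F • G : Linf) x = F x * G x := by
  filter_upwards [Lp.coeFn_lpSMul (r := ∞) F G] with x hx
  simpa using hx

theorem one_mul_linf (F : Linf) : (oneLinf • F : Linf) = F := by
  apply Lp.ext
  filter_upwards [mul_ae oneLinf F, oneLinf_ae] with x h1 h2
  rw [h1, h2, one_mul]

/-! ### Characters and Gelfand duality for real $L_\infty$. -/

theorem gelfand_mul (F G : Linf) (χ : GelfandSpectrum) :
    gelfand (F • G : Linf) χ = gelfand F χ * gelfand G χ := χ.2.2 F G

theorem gelfand_add (F G : Linf) (χ : GelfandSpectrum) :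
    gelfand (F + G) χ = gelfand F χ + gelfand G χ := map_add χ.1 F G

theorem gelfand_sub (F G : Linf) (χ : GelfandSpectrum) :
    gelfand (F - G) χ = gelfand F χ - gelfand G χ := map_sub χ.1 F G

theorem gelfand_smul (c : ℝ) (F : Linf) (χ : GelfandSpectrum) :
    gelfand (c • F) χ = c * gelfand F χ := map_smul χ.1 c F

theorem map_oneLinf_of_ne_zero {χ : WeakDual ℝ Linf} (h0 : χ ≠ 0)
    (hm : ∀ F G : Linf, χ (F • G : Linf) = χ F * χ G) : χ oneLinf = 1 := by
  obtain ⟨F, hF⟩ : ∃ F, χ F ≠ 0 := by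
    by_contra! h
    exact h0 (DFunLike.ext _ _ h)
  have := hm oneLinf F
  rw [one_mul_linf] at this
  exact mul_right_cancel₀ hF (by rw [← this, one_mul])

theorem gelfand_one (χ : GelfandSpectrum) : gelfand oneLinf χ = 1 :=
  map_oneLinf_of_ne_zero χ.2.1 χ.2.2

/-- A nonnegative function is the square of its root, and characters preserve squares. -/
theorem gelfand_nonneg {F : Linf} (hF : ∀ᵐ x, 0 ≤ F x) (χ : GelfandSpectrum) :
    0 ≤ gelfand F χ := by
  obtain ⟨G, hG⟩ := exists_comp_ae_eq F Real.continuous_sqrt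
  have : F = (G • G : Linf) := by
    apply Lp.ext
    filter_upwards [mul_ae G G, hG, hF] with x h1 h2 h3
    rw [h1, h2, Real.mul_self_sqrt h3]
  rw [this, gelfand_mul]
  exact mul_self_nonneg _

theorem abs_gelfand_le (F : Linf) (χ : GelfandSpectrum) : |gelfand F χ| ≤ ‖F‖ := by
  have h1 : 0 ≤ gelfand (‖F‖ • oneLinf - F) χ := by
    apply gelfand_nonneg
    filter_upwards [ae_abs_le_norm F, oneLinf_ae, Lp.coeFn_sub (‖F‖ • oneLinf) F,
      Lp.coeFn_smul ‖F‖ oneLinf] with x h h2 h3 h4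
    rw [h3, Pi.sub_apply, h4, Pi.smul_apply, h2, smul_eq_mul]
    linarith [abs_le.mp h]
  have h2 : 0 ≤ gelfand (‖F‖ • oneLinf + F) χ := by
    apply gelfand_nonneg
    filter_upwards [ae_abs_le_norm F, oneLinf_ae, Lp.coeFn_add (‖F‖ • oneLinf) F,
      Lp.coeFn_smul ‖F‖ oneLinf] with x h h2 h3 h4
    rw [h3, Pi.add_apply, h4, Pi.smul_apply, h2, smul_eq_mul]
    linarith [abs_le.mp h]
  rw [gelfand_sub, gelfand_smul, gelfand_one] at h1
  rw [gelfand_add, gelfand_smul, gelfand_one] at h2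
  rw [abs_le]
  constructor <;> linarith

/-- An ultrafilter finer than the almost everywhere filter defines a character by taking limits. -/
theorem exists_character_of_ultrafilter (U : Ultrafilter Circ)
    (hU : (U : Filter Circ) ≤ ae volume) :
    ∃ χ : GelfandSpectrum, ∀ F : Linf, Tendsto F U (𝓝 (gelfand F χ)) := by
  have hlim : ∀ F : Linf, ∃ c, |c| ≤ ‖F‖ ∧ Tendsto F U (𝓝 c) := by
    intro F
    have hmem : Icc (-‖F‖) ‖F‖ ∈ U.map F := by
      have := hU (ae_abs_le_norm F)
      exact Filter.mem_of_superset this fun x hx => abs_le.mp hx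
    obtain ⟨c, hc, hc'⟩ := isCompact_Icc.ultrafilter_le_nhds' _ hmem
    exact ⟨c, abs_le.mpr hc, hc'⟩
  -- Uniqueness of limits along $U$ makes `c` linear and multiplicative; $U$ being finer than the
  -- a.e. filter lets a.e. identities pass to the limit.
  choose c hcn hct using hlim
  have hadd : ∀ F G, c (F + G) = c F + c G := fun F G =>
    tendsto_nhds_unique ((hct (F + G)).congr' (hU (Lp.coeFn_add F G))) ((hct F).add (hct G))
  have hsmul : ∀ (r : ℝ) F, c (r • F) = r * c F := fun r F =>
    tendsto_nhds_unique ((hct (r • F)).congr' (hU (Lp.coeFn_smul r F))) ((hct F).const_mul r)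
  have hmul : ∀ F G : Linf, c (F • G : Linf) = c F * c G := fun F G =>
    tendsto_nhds_unique ((hct (F • G : Linf)).congr' (hU (mul_ae F G))) ((hct F).mul (hct G))
  have hone : c oneLinf = 1 :=
    tendsto_nhds_unique ((hct oneLinf).congr' (hU oneLinf_ae)) tendsto_const_nhds
  let l : StrongDual ℝ Linf := LinearMap.mkContinuous
    { toFun := c, map_add' := hadd, map_smul' := hsmul } 1 (by simpa using hcn)
  refine ⟨⟨StrongDual.toWeakDual l, fun h => ?_, hmul⟩, hct⟩
  have h1 : c oneLinf = 0 := DFunLike.congr_fun h oneLinf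
  rw [hone] at h1
  exact one_ne_zero h1

/-- The set where $|F|\ge\|F\|-\varepsilon$ is not null, so some ultrafilter finer than the a.e.
filter contains it; its limit character works. -/
theorem exists_character_norm_sub_lt (F : Linf) {ε : ℝ} (hε : 0 < ε) :
    ∃ χ : GelfandSpectrum, ‖F‖ - ε ≤ |gelfand F χ| := by
  have hne : (ae volume ⊓ 𝓟 {x | ‖F‖ - ε ≤ |F x|} : Filter Circ).NeBot := by
    rw [← frequently_mem_iff_neBot]
    intro h
    by_cases hF : ‖F‖ - ε < 0
    · obtain ⟨x, hx⟩ := h.exists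
      exact hx (hF.le.trans (abs_nonneg _))
    · push Not at hF
      have := norm_le_of_ae_abs_le hF (h.mono fun x hx => (not_le.mp hx).le)
      linarith
  obtain ⟨U, hU⟩ := Ultrafilter.exists_le (ae volume ⊓ 𝓟 {x | ‖F‖ - ε ≤ |F x|} : Filter Circ)
  obtain ⟨χ, hχ⟩ := exists_character_of_ultrafilter U (hU.trans inf_le_left)
  refine ⟨χ, ge_of_tendsto (hχ F).abs ?_⟩
  exact hU (mem_inf_of_right (mem_principal_self _))

namespace GelfandSpectrum

instance : T2Space GelfandSpectrum :=
  inferInstanceAs (T2Space {χ : WeakDual ℝ Linf //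
    χ ≠ 0 ∧ ∀ F G : Linf, χ (F • G : Linf) = χ F * χ G})

/-- Banach–Alaoglu. For multiplicative functionals, $\chi\ne 0$ is equivalent to the weak-* closed
condition $\chi(1)=1$. -/
theorem isCompact_characters : IsCompact {χ : WeakDual ℝ Linf |
    χ ≠ 0 ∧ ∀ F G : Linf, χ (F • G : Linf) = χ F * χ G} := by
  refine (WeakDual.isCompact_closedBall (0 : StrongDual ℝ Linf) 1).of_isClosed_subset ?_ ?_
  · have : {χ : WeakDual ℝ Linf | χ ≠ 0 ∧ ∀ F G : Linf, χ (F • G : Linf) = χ F * χ G} =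
        {χ : WeakDual ℝ Linf | χ oneLinf = 1} ∩
          ⋂ (F : Linf) (G : Linf), {χ : WeakDual ℝ Linf | χ (F • G : Linf) = χ F * χ G} := by
      ext χ
      simp only [mem_ofPred_eq, mem_inter_iff, mem_iInter]
      refine ⟨fun h => ⟨map_oneLinf_of_ne_zero h.1 h.2, h.2⟩, fun h => ⟨?_, h.2⟩⟩
      rintro rfl
      exact zero_ne_one (α := ℝ) h.1
    rw [this]
    refine (isClosed_eq (WeakDual.eval_continuous _) continuous_const).inter ?_
    refine isClosed_iInter fun F => isClosed_iInter fun G => ?_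
    exact isClosed_eq (WeakDual.eval_continuous _)
      ((WeakDual.eval_continuous _).mul (WeakDual.eval_continuous _))
  · intro χ hχ
    rw [mem_preimage, mem_closedBall_zero_iff]
    refine ContinuousLinearMap.opNorm_le_bound _ zero_le_one fun F => ?_
    rw [one_mul]
    exact abs_gelfand_le F ⟨χ, hχ⟩

instance : CompactSpace GelfandSpectrum :=
  isCompact_iff_compactSpace.mp isCompact_characters

end GelfandSpectrum

/-- The Gelfand transform as a linear isometry into the continuous functions. -/
def gelfandIsometry : Linf →ₗᵢ[ℝ] C(GelfandSpectrum, ℝ) where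
  toFun F := ⟨gelfand F, continuous_gelfand F⟩
  map_add' F G := ContinuousMap.ext (gelfand_add F G)
  map_smul' c F := ContinuousMap.ext (gelfand_smul c F)
  norm_map' F := by
    apply le_antisymm
    · exact (ContinuousMap.norm_le _ (norm_nonneg F)).mpr fun χ => abs_gelfand_le F χ
    · refine le_of_forall_pos_le_add fun ε hε => ?_
      obtain ⟨χ, hχ⟩ := exists_character_norm_sub_lt F hε
      have := ContinuousMap.norm_coe_le_norm (⟨gelfand F, continuous_gelfand F⟩ :
        C(GelfandSpectrum, ℝ)) χ
      rw [Real.norm_eq_abs] at this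
      change |gelfand F χ| ≤ _ at this
      simp only [LinearMap.coe_mk, AddHom.coe_mk]
      linarith

theorem gelfandIsometry_apply (F : Linf) (χ : GelfandSpectrum) :
    gelfandIsometry F χ = gelfand F χ := rfl

/-- The Gelfand transforms form a subalgebra of the continuous functions. -/
def gelfandSubalgebra : Subalgebra ℝ C(GelfandSpectrum, ℝ) where
  carrier := range gelfandIsometry
  mul_mem' := by
    rintro _ _ ⟨F, rfl⟩ ⟨G, rfl⟩
    exact ⟨(F • G : Linf), ContinuousMap.ext (gelfand_mul F G)⟩
  add_mem' := by
    rintro _ _ ⟨F, rfl⟩ ⟨G, rfl⟩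
    exact ⟨F + G, map_add _ F G⟩
  algebraMap_mem' c := by
    refine ⟨c • oneLinf, ContinuousMap.ext fun χ => ?_⟩
    rw [gelfandIsometry_apply, gelfand_smul, gelfand_one, mul_one]
    rfl

/-- The range is dense by Stone–Weierstrass and closed because the map is an isometry of a complete
space. -/
theorem gelfandIsometry_surjective : Function.Surjective gelfandIsometry := by
  have hsep : gelfandSubalgebra.SeparatesPoints := by
    intro χ ψ h
    obtain ⟨F, hF⟩ : ∃ F, gelfand F χ ≠ gelfand F ψ := by
      by_contra! h'
      exact h (Subtype.ext (DFunLike.ext _ _ h'))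
    exact ⟨_, ⟨gelfandIsometry F, ⟨F, rfl⟩, rfl⟩, hF⟩
  have htop := ContinuousMap.subalgebra_topologicalClosure_eq_top_of_separatesPoints _ hsep
  have hclosed : IsClosed (gelfandSubalgebra : Set C(GelfandSpectrum, ℝ)) :=
    gelfandIsometry.isometry.isClosedEmbedding.isClosed_range
  intro f
  have hf : f ∈ gelfandSubalgebra.topologicalClosure := htop ▸ Algebra.mem_top
  exact hclosed.closure_subset hf

/-- Gelfand duality: `L_∞` is isometric to the continuous functions on its spectrum. -/
def gelfandEquiv : Linf ≃ₗᵢ[ℝ] C(GelfandSpectrum, ℝ) :=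
  LinearIsometryEquiv.ofSurjective gelfandIsometry gelfandIsometry_surjective

/-! ### Riesz representation of the dual of $C(X)$ for compact $X$. -/

section Riesz

variable {X : Type*} [TopologicalSpace X] [CompactSpace X]

/-- The cone of pairs `(F, t)` such that `-Φ G ≤ t` for some `0 ≤ G ≤ F`. -/
def dominationCone (Φ : StrongDual ℝ C(X, ℝ)) : PointedCone ℝ (C(X, ℝ) × ℝ) where
  carrier := {p | ∃ G : C(X, ℝ), 0 ≤ G ∧ G ≤ p.1 ∧ -Φ G ≤ p.2}
  add_mem' := by
    rintro p q ⟨G, hG, hGp, hp⟩ ⟨H, hH, hHq, hq⟩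
    refine ⟨G + H, add_nonneg hG hH, add_le_add hGp hHq, ?_⟩
    rw [map_add, neg_add]
    exact add_le_add hp hq
  zero_mem' := ⟨0, le_rfl, le_rfl, by simp⟩
  smul_mem' := by
    rintro ⟨c, hc⟩ p ⟨G, hG, hGp, hp⟩
    refine ⟨c • G, fun x => mul_nonneg hc (hG x), fun x => ?_, ?_⟩
    · exact mul_le_mul_of_nonneg_left (hGp x) hc
    · rw [map_smul, smul_eq_mul]
      have := mul_le_mul_of_nonneg_left hp hc
      change -(c * Φ G) ≤ c * p.2
      linarith

/-- A bounded functional on `C(X, ℝ)` is dominated by a positive one. -/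
theorem exists_positive_dominating (Φ : StrongDual ℝ C(X, ℝ)) :
    ∃ P : C(X, ℝ) →ₗ[ℝ] ℝ, (∀ F, 0 ≤ F → 0 ≤ P F) ∧ ∀ F, 0 ≤ F → Φ F ≤ P F := by
  rcases isEmpty_or_nonempty X with hX | ⟨⟨x₀⟩⟩
  · refine ⟨0, fun F _ => le_rfl, fun F _ => ?_⟩
    rw [Subsingleton.elim F 0, map_zero, map_zero]
  let L : C(X, ℝ) × ℝ →ₗ[ℝ] ℝ :=
    { toFun := fun p => ‖Φ‖ * p.1 x₀ + p.2
      map_add' := fun p q => by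
        simp only [Prod.fst_add, ContinuousMap.add_apply, Prod.snd_add]; ring
      map_smul' := fun c p => by
        simp only [Prod.smul_fst, ContinuousMap.smul_apply, smul_eq_mul, Prod.smul_snd,
          RingHom.id_apply]
        ring }
  -- On $\mathbb R 1\times\mathbb R$ the functional is $(c,t)\mapsto\|\Phi\|c+t$. It is nonnegative
  -- on the cone: $0\le G\le c$ gives $-t\le\Phi G\le\|\Phi\|c$.
  let D : Submodule ℝ (C(X, ℝ) × ℝ) := (Submodule.span ℝ {(1 : C(X, ℝ))}).prod ⊤
  let f : (C(X, ℝ) × ℝ) →ₗ.[ℝ] ℝ := ⟨D, L.comp D.subtype⟩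
  obtain ⟨g, hgf, hg⟩ := riesz_extension (dominationCone Φ) f
    (by
      rintro ⟨⟨F, t⟩, hF⟩ ⟨G, hG, hGF, ht⟩
      obtain ⟨c, rfl⟩ := Submodule.mem_span_singleton.mp hF.1
      change 0 ≤ ‖Φ‖ * (c * 1) + t
      have hc : 0 ≤ c * 1 := (hG x₀).trans (hGF x₀)
      have hnorm : ‖G‖ ≤ c := by
        rw [mul_one] at hc
        refine (ContinuousMap.norm_le _ hc).mpr fun x => ?_
        refine (Real.norm_of_nonneg (hG x)).trans_le ?_
        exact (hGF x).trans (mul_one c).le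
      have h1 : Φ G ≤ ‖Φ‖ * c := (le_abs_self _).trans
        ((Φ.le_opNorm G).trans (mul_le_mul_of_nonneg_left hnorm (norm_nonneg _)))
      change -Φ G ≤ t at ht
      linarith)
    (by
      rintro ⟨F, t⟩
      refine ⟨⟨(‖F‖ • 1, |t|), Submodule.smul_mem _ _ (Submodule.mem_span_singleton_self _),
        trivial⟩, 0, le_rfl, fun x => ?_, ?_⟩
      · have h := (abs_le.mp (F.norm_coe_le_norm x)).1
        change 0 ≤ ‖F‖ * 1 + F x
        linarith
      · rw [map_zero, neg_zero]
        change 0 ≤ |t| + t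
        linarith [neg_abs_le t])
  have hg0 : ∀ t, g (0, t) = t := fun t => by
    have := hgf ⟨(0, t), Submodule.zero_mem _, trivial⟩
    refine this.trans ?_
    change ‖Φ‖ * 0 + t = t
    ring
  have hsplit : ∀ F t, g (F, t) = g (F, 0) + t := fun F t => by
    rw [← hg0 t, ← map_add]
    simp [hg0]
  refine ⟨g.comp (LinearMap.inl ℝ _ _), fun F hF => ?_, fun F hF => ?_⟩
  -- The two required inequalities come from the witnesses $G=0$ for $(F,0)$ and $G=F$ for $(F,-\Phi
  -- F)$.
  · exact hg (F, 0) ⟨0, le_rfl, hF, by simp⟩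
  · have h := hg (F, -Φ F) ⟨F, hF, le_rfl, le_rfl⟩
    rw [hsplit] at h
    change Φ F ≤ g (F, 0)
    linarith

variable [T2Space X] [MeasurableSpace X] [BorelSpace X]

/-- **Riesz–Markov–Kakutani** for a positive functional on a compact space. -/
theorem exists_regular_measure_of_positive (P : C(X, ℝ) →ₗ[ℝ] ℝ) (hP : ∀ F, 0 ≤ F → 0 ≤ P F) :
    ∃ μ : Measure X, μ.Regular ∧ IsFiniteMeasure μ ∧ ∀ f : C(X, ℝ), ∫ x, f x ∂μ = P f := by
  let l : CompactlySupportedContinuousMap X ℝ →ₗ[ℝ] ℝ :=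
    { toFun := fun f => P f.toContinuousMap
      map_add' := fun f g => map_add P f.toContinuousMap g.toContinuousMap
      map_smul' := fun c f => map_smul P c f.toContinuousMap }
  let Λ := PositiveLinearMap.mk₀ l fun f hf => hP _ hf
  refine ⟨RealRMK.rieszMeasure Λ, inferInstance, inferInstance, fun f => ?_⟩
  exact RealRMK.integral_rieszMeasure Λ (CompactlySupportedContinuousMap.continuousMapEquiv f)

/-- A measure dominated by a finite regular measure is regular. -/
theorem regular_of_le {μ ν : Measure X} [μ.Regular] [IsFiniteMeasure μ] (h : ν ≤ μ) :
    ν.Regular := by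
  have hν : IsFiniteMeasure ν := isFiniteMeasure_of_le μ h
  have hin : ν.InnerRegularWRT IsClosed IsOpen := by
    intro U hU r hr
    -- Since $\nu(U\setminus K)\le\mu(U\setminus K)<\nu(U)-r$, the compact set $K$ keeps more than
    -- $r$ of the $\nu$-mass.
    obtain ⟨K, hKU, hK, hlt⟩ := hU.measurableSet.exists_isCompact_sdiff_lt (μ := μ)
      (measure_ne_top _ _) (tsub_pos_of_lt hr).ne'
    refine ⟨K, hKU, hK.isClosed, ?_⟩
    by_contra! hle
    have h1 : ν U ≤ ν K + ν (U \ K) := by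
      rw [← union_sdiff_cancel hKU]
      refine (measure_union_le _ _).trans ?_
      rw [union_sdiff_cancel hKU]
    have h2 : ν U < ν U := calc
      ν U ≤ r + ν (U \ K) := h1.trans (by gcongr)
      _ ≤ r + μ (U \ K) := by gcongr
      _ < r + (ν U - r) := ENNReal.add_lt_add_left hr.ne_top hlt
      _ = ν U := add_tsub_cancel_of_le hr.le
    exact lt_irrefl _ h2
  have hw := hin.weaklyRegular_of_finite
  exact
    { hw.toOuterRegular with
      innerRegular := fun U hU r hr => by
        obtain ⟨K, hKU, hK, hrK⟩ := hw.innerRegular hU r hr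
        exact ⟨K, hKU, hK.isCompact, hrK⟩ }

omit [TopologicalSpace X] [CompactSpace X] [T2Space X] [BorelSpace X] in
theorem isFiniteMeasure_variation (m : SignedMeasure X) : IsFiniteMeasure m.variation := by
  rw [← m.totalVariation_eq_variation]
  infer_instance

omit [CompactSpace X] [T2Space X] [BorelSpace X] [TopologicalSpace X] in
theorem vectorIntegral_toSignedMeasure (μ : Measure X) [IsFiniteMeasure μ] (f : X → ℝ) :
    ∫ᵛ x, f x ∂•μ.toSignedMeasure = ∫ x, f x ∂μ := by
  rw [← VectorMeasure.integral_toSignedMeasure]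
  congr 1
  ext
  rfl

omit [T2Space X] in
theorem integrable_variation (m : SignedMeasure X) (f : C(X, ℝ)) : m.Integrable f := by
  have := isFiniteMeasure_variation m
  exact f.continuous.integrable_of_hasCompactSupport (HasCompactSupport.of_compactSpace _)

omit [T2Space X] in
theorem vectorIntegral_sub_toSignedMeasure (μ ν : Measure X) [IsFiniteMeasure μ]
    [IsFiniteMeasure ν] (f : C(X, ℝ)) :
    ∫ᵛ x, f x ∂•(μ.toSignedMeasure - ν.toSignedMeasure) = ∫ x, f x ∂μ - ∫ x, f x ∂ν := by
  rw [VectorMeasure.integral_sub_vectorMeasure (integrable_variation _ f)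
    (integrable_variation _ f), vectorIntegral_toSignedMeasure, vectorIntegral_toSignedMeasure]

omit [T2Space X] in
theorem vectorIntegral_eq_jordan (m : SignedMeasure X) (f : C(X, ℝ)) :
    ∫ᵛ x, f x ∂•m = ∫ x, f x ∂m.toJordanDecomposition.posPart -
      ∫ x, f x ∂m.toJordanDecomposition.negPart := by
  rw [← vectorIntegral_sub_toSignedMeasure]
  congr 1
  exact m.toSignedMeasure_toJordanDecomposition.symm

omit [T2Space X] in
theorem integrable_of_isFiniteMeasure (μ : Measure X) [IsFiniteMeasure μ] (f : C(X, ℝ)) :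
    Integrable f μ :=
  f.continuous.integrable_of_hasCompactSupport (HasCompactSupport.of_compactSpace _)

omit [TopologicalSpace X] [CompactSpace X] [T2Space X] [BorelSpace X] in
theorem totalVariation_sub_le (μ ν : Measure X) [IsFiniteMeasure μ] [IsFiniteMeasure ν] :
    (μ.toSignedMeasure - ν.toSignedMeasure).totalVariation ≤ μ + ν := by
  rw [SignedMeasure.totalVariation_eq_variation]
  refine VectorMeasure.variation_sub_le.trans ?_
  rw [Measure.variation_toSignedMeasure, Measure.variation_toSignedMeasure]

/-- **Riesz representation** of a bounded functional on `C(X, ℝ)` by a regular signed measure. -/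
theorem exists_regular_signedMeasure (Φ : StrongDual ℝ C(X, ℝ)) :
    ∃ m : SignedMeasure X, m.totalVariation.Regular ∧ ∀ f : C(X, ℝ), ∫ᵛ x, f x ∂•m = Φ f := by
  obtain ⟨P, hP, hΦP⟩ := exists_positive_dominating Φ
  obtain ⟨μ, hμr, hμf, hμ⟩ := exists_regular_measure_of_positive P hP
  -- $\Phi=P-(P-\Phi)$ is a difference of positive functionals.
  obtain ⟨ν, hνr, hνf, hν⟩ := exists_regular_measure_of_positive (P - Φ.toLinearMap)
    fun F hF => sub_nonneg.mpr (hΦP F hF)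
  refine ⟨μ.toSignedMeasure - ν.toSignedMeasure, regular_of_le (totalVariation_sub_le μ ν),
    fun f => ?_⟩
  rw [vectorIntegral_sub_toSignedMeasure, hμ, hν]
  exact sub_sub_cancel _ _

omit [TopologicalSpace X] [CompactSpace X] [T2Space X] [BorelSpace X] in
theorem posPart_le_totalVariation (m : SignedMeasure X) :
    m.toJordanDecomposition.posPart ≤ m.totalVariation := Measure.le_add_right le_rfl

omit [TopologicalSpace X] [CompactSpace X] [T2Space X] [BorelSpace X] in
theorem negPart_le_totalVariation (m : SignedMeasure X) :
    m.toJordanDecomposition.negPart ≤ m.totalVariation := Measure.le_add_left le_rfl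

/-- Regular signed measures are determined by the integrals of continuous functions. -/
theorem signedMeasure_ext {m n : SignedMeasure X} (hm : m.totalVariation.Regular)
    (hn : n.totalVariation.Regular) (h : ∀ f : C(X, ℝ), ∫ᵛ x, f x ∂•m = ∫ᵛ x, f x ∂•n) :
    m = n := by
  have := regular_of_le (posPart_le_totalVariation m)
  have := regular_of_le (posPart_le_totalVariation n)
  have := regular_of_le (negPart_le_totalVariation m)
  have := regular_of_le (negPart_le_totalVariation n)
  -- Moving the negative parts across turns the claim into uniqueness for positive regular measures.
  have heq : m.toJordanDecomposition.posPart + n.toJordanDecomposition.negPart =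
      n.toJordanDecomposition.posPart + m.toJordanDecomposition.negPart := by
    refine Measure.ext_of_integral_eq_on_compactlySupported fun f => ?_
    change ∫ x, f.toContinuousMap x ∂_ = ∫ x, f.toContinuousMap x ∂_
    have hf := h f.toContinuousMap
    rw [vectorIntegral_eq_jordan, vectorIntegral_eq_jordan] at hf
    rw [integral_add_measure (integrable_of_isFiniteMeasure _ f.toContinuousMap)
      (integrable_of_isFiniteMeasure _ f.toContinuousMap),
      integral_add_measure (integrable_of_isFiniteMeasure _ f.toContinuousMap)
      (integrable_of_isFiniteMeasure _ f.toContinuousMap)]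
    exact sub_eq_sub_iff_add_eq_add.mp hf
  rw [← m.toSignedMeasure_toJordanDecomposition, ← n.toSignedMeasure_toJordanDecomposition]
  refine sub_eq_sub_iff_add_eq_add.mpr ?_
  rw [← Measure.toSignedMeasure_add, ← Measure.toSignedMeasure_add]
  exact Measure.toSignedMeasure_congr heq

-- The function $1-f$ vanishes on $K$ and is at most $2$ elsewhere.
omit [T2Space X] in
theorem measureReal_sub_integral_le {μ : Measure X} [IsFiniteMeasure μ] {K : Set X}
    (hK : IsClosed K) {f : C(X, ℝ)} (hf : ∀ x, -1 ≤ f x) (hfK : ∀ x ∈ K, f x = 1) :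
    μ.real univ - ∫ x, f x ∂μ ≤ 2 * μ.real Kᶜ := by
  have h1 : ∫ x, (1 - f x) ∂μ ≤ ∫ x, Kᶜ.indicator (fun _ => (2 : ℝ)) x ∂μ := by
    refine integral_mono ((integrable_const 1).sub (integrable_of_isFiniteMeasure μ f))
      ((integrable_const 2).indicator hK.measurableSet.compl) fun x => ?_
    by_cases hx : x ∈ K
    · simp [hx, hfK]
    · simp only [mem_compl_iff, hx, not_false_eq_true, indicator_of_mem]
      linarith [hf x]
  rw [integral_sub (integrable_const 1) (integrable_of_isFiniteMeasure μ f),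
    integral_indicator_const _ hK.measurableSet.compl] at h1
  simp only [integral_const, smul_eq_mul, mul_one] at h1
  linarith

/-- The total variation of a regular signed measure is the norm of the functional it defines. -/
theorem totalVariation_real_univ_eq_norm {Φ : StrongDual ℝ C(X, ℝ)} {m : SignedMeasure X}
    (hreg : m.totalVariation.Regular) (hm : ∀ f : C(X, ℝ), ∫ᵛ x, f x ∂•m = Φ f) :
    m.totalVariation.real univ = ‖Φ‖ := by
  apply le_antisymm
  · obtain ⟨s, hs, hps, hns⟩ := m.toJordanDecomposition.mutuallySingular
    set μ := m.toJordanDecomposition.posPart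
    set ν := m.toJordanDecomposition.negPart
    refine le_of_forall_pos_le_add fun ε hε => ?_
    have hε' : ENNReal.ofReal (ε / 4) ≠ 0 := by simpa using hε
    obtain ⟨K, hKs, hK, hKlt⟩ := hs.exists_isCompact_sdiff_lt (μ := m.totalVariation)
      (measure_ne_top _ _) hε'
    obtain ⟨L, hLs, hL, hLlt⟩ := hs.compl.exists_isCompact_sdiff_lt (μ := m.totalVariation)
      (measure_ne_top _ _) hε'
    obtain ⟨g, hgK, hgL, hg⟩ := exists_continuous_zero_one_of_isClosed hK.isClosed hL.isClosed
      (disjoint_compl_right.mono hKs hLs)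
    -- A continuous approximation to the Hahn sign: $-1$ on $K\subseteq s$, where `ν` lives, and
    -- $+1$ on $L\subseteq s^c$, where `μ` lives. Each part loses at most $2\cdot\varepsilon/4$.
    let f : C(X, ℝ) := (2 : ℝ) • g - 1
    have hfx : ∀ x, f x = 2 * g x - 1 := fun x => by simp [f]
    have hf1 : ‖f‖ ≤ 1 := by
      refine (ContinuousMap.norm_le _ zero_le_one).mpr fun x => ?_
      rw [hfx, Real.norm_eq_abs, abs_le]
      constructor <;> linarith [(hg x).1, (hg x).2]
    have hμL : μ.real Lᶜ ≤ ε / 4 := by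
      refine ENNReal.toReal_le_of_le_ofReal (by positivity) ?_
      calc μ Lᶜ ≤ μ (s ∪ (sᶜ \ L)) := measure_mono fun x hx => by
            by_cases hxs : x ∈ s
            · exact Or.inl hxs
            · exact Or.inr ⟨hxs, hx⟩
        _ ≤ μ s + μ (sᶜ \ L) := measure_union_le _ _
        _ ≤ 0 + m.totalVariation (sᶜ \ L) := by
            rw [hps]; gcongr; exact posPart_le_totalVariation m
        _ ≤ ENNReal.ofReal (ε / 4) := by rw [zero_add]; exact hLlt.le
    have hνK : ν.real Kᶜ ≤ ε / 4 := by
      refine ENNReal.toReal_le_of_le_ofReal (by positivity) ?_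
      calc ν Kᶜ ≤ ν (sᶜ ∪ (s \ K)) := measure_mono fun x hx => by
            by_cases hxs : x ∈ s
            · exact Or.inr ⟨hxs, hx⟩
            · exact Or.inl hxs
        _ ≤ ν sᶜ + ν (s \ K) := measure_union_le _ _
        _ ≤ 0 + m.totalVariation (s \ K) := by
            rw [hns]; gcongr; exact negPart_le_totalVariation m
        _ ≤ ENNReal.ofReal (ε / 4) := by rw [zero_add]; exact hKlt.le
    have h1 := measureReal_sub_integral_le (μ := μ) hL.isClosed (f := f)
      (fun x => by rw [hfx]; linarith [(hg x).1])
      (fun x hx => by rw [hfx, hgL hx]; norm_num)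
    have h2 := measureReal_sub_integral_le (μ := ν) hK.isClosed (f := -f)
      (fun x => by rw [ContinuousMap.neg_apply, hfx]; linarith [(hg x).2])
      (fun x hx => by rw [ContinuousMap.neg_apply, hfx, hgK hx]; norm_num)
    simp only [ContinuousMap.neg_apply, integral_neg] at h2
    have h3 := hm f
    rw [vectorIntegral_eq_jordan] at h3
    have h4 : Φ f ≤ ‖Φ‖ := (le_abs_self _).trans (Φ.unit_le_opNorm f hf1)
    have h5 : m.totalVariation.real univ = μ.real univ + ν.real univ :=
      measureReal_add_apply
    linarith
  · refine ContinuousLinearMap.opNorm_le_bound _ measureReal_nonneg fun f => ?_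
    have := isFiniteMeasure_variation m
    rw [← hm]
    refine (VectorMeasure.norm_integral_le_of_norm_le_const
      (Eventually.of_forall f.norm_coe_le_norm)).trans ?_
    rw [m.totalVariation_eq_variation, mul_comm]
    have h1 : ‖(ContinuousLinearMap.lsmul ℝ ℝ : ℝ →L[ℝ] ℝ →L[ℝ] ℝ)‖ ≤ 1 :=
      ContinuousLinearMap.opNorm_lsmul_le
    gcongr
    exact mul_le_of_le_one_right (norm_nonneg f) h1

end Riesz

/-! ### Lipschitz curves and measurable norming selections in a normed space. -/

section Curves

variable {E : Type*} [NormedAddCommGroup E] [NormedSpace ℝ E]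

theorem dual_apply_le (f : StrongDual ℝ E) (v : E) : f v ≤ ‖f‖ * ‖v‖ :=
  (Real.le_norm_self _).trans (f.le_opNorm v)

theorem continuous_norm_sub_smul (Φ Λ : StrongDual ℝ E) :
    Continuous fun τ : ℝ => ‖Φ - τ • Λ‖ := by fun_prop

/-- An integration by parts inequality along a `1`-Lipschitz curve `ω`, which need not be
differentiable: formally the left side is `∫ (Φ - τ Λ)(ω' τ) dτ`. -/
theorem sub_add_integral_le_integral_norm (Φ Λ : StrongDual ℝ E) {ω : ℝ → E}
    (hω : ∀ s t, ‖ω t - ω s‖ ≤ |t - s|) :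
    Φ (ω 1) - Φ (ω 0) - Λ (ω 1) + ∫ s in (0 : ℝ)..1, Λ (ω s) ≤
      ∫ τ in (0 : ℝ)..1, ‖Φ - τ • Λ‖ := by
  have hωc : Continuous ω := by
    refine (LipschitzWith.of_dist_le_mul (K := 1) fun t s => ?_).continuous
    rw [dist_eq_norm, Real.dist_eq, NNReal.coe_one, one_mul]
    exact hω s t
  have hΛ : Continuous fun s => Λ (ω s) := Λ.continuous.comp hωc
  have hN := continuous_norm_sub_smul Φ Λ
  -- Formally $g'(t)=(\Phi-t\Lambda)(\omega'(t))$. Without differentiability, `hstep` still bounds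
  -- the right slopes by $\|\Phi-x\Lambda\|+o(1)$, enough for comparison with `B`.
  let g : ℝ → ℝ := fun t => Φ (ω t) - t * Λ (ω t) + ∫ s in (0 : ℝ)..t, Λ (ω s)
  let B : ℝ → ℝ := fun t => Φ (ω 0) + ∫ τ in (0 : ℝ)..t, ‖Φ - τ • Λ‖
  have hB : ∀ x, HasDerivAt B ‖Φ - x • Λ‖ x := fun x =>
    (intervalIntegral.integral_hasDerivAt_right (hN.intervalIntegrable _ _)
      (hN.stronglyMeasurableAtFilter _ _) hN.continuousAt).const_add _
  have hg : Continuous g := by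
    refine ((Φ.continuous.comp hωc).sub (continuous_id.mul hΛ)).add ?_
    exact intervalIntegral.continuous_primitive (fun a b => hΛ.intervalIntegrable a b) 0
  have hstep : ∀ x z, x < z → g z - g x ≤ (‖Φ - x • Λ‖ + ‖Λ‖ * (z - x)) * (z - x) := by
    intro x z hxz
    have h1 : (Φ - x • Λ) (ω z - ω x) ≤ ‖Φ - x • Λ‖ * (z - x) := by
      refine (dual_apply_le _ _).trans ?_
      gcongr
      exact (hω x z).trans_eq (abs_of_pos (sub_pos.mpr hxz))
    have h2 : ∫ s in x..z, Λ (ω s) ≤ (z - x) * (Λ (ω z) + ‖Λ‖ * (z - x)) := by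
      rw [← smul_eq_mul (z - x), ← intervalIntegral.integral_const]
      refine intervalIntegral.integral_mono_on hxz.le (hΛ.intervalIntegrable _ _)
        intervalIntegrable_const fun s hs => ?_
      have h3 : Λ (ω s - ω z) ≤ ‖Λ‖ * (z - x) := by
        refine (dual_apply_le _ _).trans ?_
        gcongr
        refine (hω z s).trans ?_
        rw [abs_le]
        constructor <;> linarith [hs.1, hs.2]
      rw [map_sub] at h3
      linarith
    have h4 : ∫ s in (0 : ℝ)..z, Λ (ω s) = (∫ s in (0 : ℝ)..x, Λ (ω s)) + ∫ s in x..z, Λ (ω s) :=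
      (intervalIntegral.integral_add_adjacent_intervals (hΛ.intervalIntegrable _ _)
        (hΛ.intervalIntegrable _ _)).symm
    have h5 : (Φ - x • Λ) (ω z - ω x) = Φ (ω z) - Φ (ω x) - x * (Λ (ω z) - Λ (ω x)) := by
      simp only [map_sub, sub_apply, smul_apply,
        smul_eq_mul]
      ring
    simp only [g]
    rw [h4]
    linarith
  have hle := image_le_of_liminf_slope_right_le_deriv_boundary (f := g) (a := 0) (b := 1)
    hg.continuousOn (B := B) (B' := fun x => ‖Φ - x • Λ‖)
    (by simp [g, B])
    (fun x _ => (hB x).continuousAt.continuousWithinAt)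
    (fun x _ => (hB x).hasDerivWithinAt)
    (by
      intro x _ r hr
      refine Eventually.frequently ?_
      have hc : ContinuousWithinAt (fun z => ‖Φ - x • Λ‖ + ‖Λ‖ * (z - x)) (Ioi x) x := by
        fun_prop
      have hlt := hc.eventually_lt continuousWithinAt_const (by simpa using hr)
      filter_upwards [hlt, self_mem_nhdsWithin] with z hz hxz
      refine lt_of_le_of_lt ?_ hz
      rw [slope_def_field, div_le_iff₀ (sub_pos.mpr hxz)]
      exact hstep x z hxz)
    (right_mem_Icc.mpr zero_le_one)
  simp only [g, B] at hle
  linarith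

/-- Near-maximizers of the functionals `Φ - τ Λ` can be chosen as a measurable function of `τ`. -/
theorem exists_stronglyMeasurable_norming (Φ Λ : StrongDual ℝ E) {ε : ℝ} (hε : 0 < ε) :
    ∃ σ : ℝ → E, StronglyMeasurable σ ∧ (∀ τ, ‖σ τ‖ ≤ 1) ∧
      ∀ τ, ‖Φ - τ • Λ‖ - ε ≤ (Φ - τ • Λ) (σ τ) := by
  have hs : ∀ c : ℝ, ∃ v : E, ‖v‖ ≤ 1 ∧ ‖Φ - c • Λ‖ - ε / 2 ≤ (Φ - c • Λ) v := by
    intro c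
    obtain ⟨v, hv, hlt⟩ := (Φ - c • Λ).exists_lt_apply_of_lt_opNorm
      (sub_lt_self ‖Φ - c • Λ‖ (half_pos hε))
    rw [Real.norm_eq_abs, lt_abs] at hlt
    rcases hlt with h | h
    · exact ⟨v, hv.le, h.le⟩
    · exact ⟨-v, by rw [norm_neg]; exact hv.le, by rw [map_neg]; exact h.le⟩
  choose v hv hvn using hs
  -- Rounding $\tau$ down to the grid $n^{-1}\mathbb Z$ costs $\|\Lambda\|/n$ twice, in the norm and
  -- in the evaluation; this $n$ keeps the sum within $\varepsilon/2$.
  obtain ⟨n, hn⟩ := exists_nat_gt (4 * ‖Λ‖ / ε)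
  have hn0 : (0 : ℝ) < n := lt_of_le_of_lt (by positivity) hn
  have hn' : 2 * (‖Λ‖ / n) ≤ ε / 2 := by
    rw [div_lt_iff₀ hε] at hn
    rw [← mul_div_assoc, div_le_iff₀ hn0]
    linarith
  refine ⟨fun τ => v (⌊n * τ⌋ / n), ?_, fun τ => hv _, fun τ => ?_⟩
  -- The selection factors through $\mathbb Z$, so strong measurability needs no separability of
  -- $E$.
  · exact (StronglyMeasurable.of_discrete (f := fun k : ℤ => v (k / n))).comp_measurable
      (Int.measurable_floor.comp (measurable_const.mul measurable_id))
  · set c : ℝ := ⌊n * τ⌋ / n with hc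
    have hcτ : |τ - c| ≤ 1 / n := by
      have h1 := Int.floor_le (n * τ)
      have h2 := Int.lt_floor_add_one (n * τ)
      have h3 : τ - c = (n * τ - ⌊n * τ⌋) / n := by rw [hc]; field_simp
      rw [h3, abs_div, abs_of_pos hn0, abs_of_nonneg (by linarith)]
      gcongr
      linarith
    have hd : ‖(τ - c) • Λ‖ ≤ ‖Λ‖ / n := by
      rw [norm_smul, Real.norm_eq_abs]
      calc |τ - c| * ‖Λ‖ ≤ 1 / n * ‖Λ‖ := by gcongr
        _ = ‖Λ‖ / n := by ring
    have h1 : Φ - τ • Λ = (Φ - c • Λ) - (τ - c) • Λ := by module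
    have h2 : ‖Φ - τ • Λ‖ ≤ ‖Φ - c • Λ‖ + ‖(τ - c) • Λ‖ := by rw [h1]; exact norm_sub_le _ _
    have h3 : ((τ - c) • Λ) (v c) ≤ ‖(τ - c) • Λ‖ :=
      (dual_apply_le _ _).trans (mul_le_of_le_one_right (norm_nonneg _) (hv c))
    have h4 : (Φ - τ • Λ) (v c) = (Φ - c • Λ) (v c) - ((τ - c) • Λ) (v c) := by
      rw [h1]; rfl
    have h5 := hvn c
    linarith

end Curves

/-! ### Lower bound: points of $D_\infty$ from measurable curves. -/

theorem exists_lOne_ae_eq (G : Linf) : ∃ Ψ : LOne, Ψ =ᵐ[volume] G :=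
  ⟨((Lp.memLp G).mono_exponent le_top).toLp _, MemLp.coeFn_toLp _⟩

theorem integrable_linf (F : Linf) : Integrable F volume :=
  (Lp.memLp F).integrable le_top

theorem oneFunctional_apply (F : Linf) : oneFunctional F = ∫ x, F x := by
  rw [oneFunctional, ofLOne_apply]
  refine integral_congr_ae ?_
  filter_upwards [Lp.coeFn_const (p := 1) (volume : Measure Circ) (1 : ℝ)] with x hx
  rw [hx, Function.const_apply, one_mul]

theorem ofLOne_sub_smul_apply_le (Ψ : LOne) (c : ℝ) {σ : Linf} (hσ : ‖σ‖ ≤ 1) :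
    (ofLOne Ψ - c • oneFunctional) σ ≤ ∫ x, |Ψ x - c| := by
  have h1 : ofLOne Ψ - c • oneFunctional = ofLOne (Ψ - c • Lp.const 1 volume (1 : ℝ)) := by
    simp only [oneFunctional, ofLOne, map_sub, map_smul]
  rw [h1, ofLOne_apply]
  have hae : ∀ᵐ x, (Ψ - c • Lp.const 1 volume (1 : ℝ) : LOne) x = Ψ x - c := by
    filter_upwards [Lp.coeFn_sub Ψ (c • Lp.const 1 volume (1 : ℝ)),
      Lp.coeFn_smul c (Lp.const 1 (volume : Measure Circ) (1 : ℝ)),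
      Lp.coeFn_const (p := 1) (volume : Measure Circ) (1 : ℝ)] with x h2 h3 h4
    rw [h2, Pi.sub_apply, h3, Pi.smul_apply, h4, Function.const_apply, smul_eq_mul, mul_one]
  have hint : Integrable (fun x => |Ψ x - c|) volume :=
    ((L1.integrable_coeFn Ψ).sub (integrable_const c)).abs
  refine (Real.le_norm_self _).trans (norm_integral_le_of_norm_le hint ?_)
  filter_upwards [hae, ae_abs_le_norm σ] with x h2 h3
  rw [h2, norm_mul]
  exact mul_le_of_le_one_right (norm_nonneg _) (h3.trans hσ)

/-- The integral is the $L_1$ norm of a point moving affinely with $\tau$. -/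
theorem continuous_integral_abs_sub (Ψ : LOne) (φ : ℝ) :
    Continuous fun τ : ℝ => ∫ x : Circ, |Ψ x - φ * τ| := by
  have h : ∀ c : ℝ, ∫ x : Circ, |Ψ x - c| = ‖Ψ - c • Lp.const 1 volume (1 : ℝ)‖ := by
    intro c
    rw [L1.norm_eq_integral_norm]
    refine integral_congr_ae ?_
    filter_upwards [Lp.coeFn_sub Ψ (c • Lp.const 1 volume (1 : ℝ)),
      Lp.coeFn_smul c (Lp.const 1 (volume : Measure Circ) (1 : ℝ)),
      Lp.coeFn_const (p := 1) (volume : Measure Circ) (1 : ℝ)] with x h2 h3 h4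
    rw [h2, Pi.sub_apply, h3, Pi.smul_apply, h4, Function.const_apply, smul_eq_mul, mul_one,
      Real.norm_eq_abs]
  simp_rw [h]
  fun_prop

/-- A measurable curve `σ` in the unit ball of `L_∞` defines a point of `L_∞ × ℝ`. -/
def curvePoint (σ : ℝ → Linf) : Linf × ℝ :=
  ((1 / (2 * π)) • ∫ τ in (0 : ℝ)..1, σ τ,
    -- One factor $1/(2\pi)$ is the normalization of $D_\infty$; the other cancels the $2\pi$ in the
    -- pairing.
    -(1 / (2 * π)) * (1 / (2 * π)) * ∫ τ in (0 : ℝ)..1, τ * oneFunctional (σ τ))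

theorem integrable_curve {σ : ℝ → Linf} (hσ : StronglyMeasurable σ) (hσ1 : ∀ τ, ‖σ τ‖ ≤ 1) :
    IntervalIntegrable σ volume 0 1 :=
  (intervalIntegrable_const (c := (1 : ℝ))).mono_fun hσ.aestronglyMeasurable
    (Eventually.of_forall fun τ => by simpa using hσ1 τ)

theorem integrable_curve_apply {σ : ℝ → Linf} (hσ : StronglyMeasurable σ)
    (hσ1 : ∀ τ, ‖σ τ‖ ≤ 1) (Φ : StrongDual ℝ Linf) :
    IntervalIntegrable (fun τ => Φ (σ τ)) volume 0 1 := by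
  rw [intervalIntegrable_iff]
  exact Φ.integrable_comp (intervalIntegrable_iff.mp (integrable_curve hσ hσ1))

theorem integrable_curve_pairing {σ : ℝ → Linf} (hσ : StronglyMeasurable σ)
    (hσ1 : ∀ τ, ‖σ τ‖ ≤ 1) (Φ : StrongDual ℝ Linf) (φ : ℝ) :
    IntervalIntegrable (fun τ : ℝ => (Φ - (φ * τ) • oneFunctional) (σ τ)) volume 0 1 :=
  (integrable_curve_apply hσ hσ1 Φ).sub
    ((integrable_curve_apply hσ hσ1 oneFunctional).continuousOn_mul
      (g := fun τ => φ * τ) (by fun_prop))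

theorem pairing_curvePoint {σ : ℝ → Linf} (hσ : StronglyMeasurable σ) (hσ1 : ∀ τ, ‖σ τ‖ ≤ 1)
    (Φ : StrongDual ℝ Linf) (φ : ℝ) :
    pairing (curvePoint σ) (Φ, φ) =
      1 / (2 * π) * ∫ τ in (0 : ℝ)..1, (Φ - (φ * τ) • oneFunctional) (σ τ) := by
  have h1 : ∫ τ in (0 : ℝ)..1, (Φ - (φ * τ) • oneFunctional) (σ τ) =
      Φ (∫ τ in (0 : ℝ)..1, σ τ) - φ * ∫ τ in (0 : ℝ)..1, τ * oneFunctional (σ τ) := by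
    rw [← Φ.intervalIntegral_comp_comm (integrable_curve hσ hσ1),
      ← intervalIntegral.integral_const_mul, ← intervalIntegral.integral_sub
        (integrable_curve_apply hσ hσ1 Φ)
        (((integrable_curve_apply hσ hσ1 oneFunctional).continuousOn_mul
          (g := fun τ => τ) continuousOn_id).const_mul φ)]
    refine intervalIntegral.integral_congr fun τ _ => ?_
    change Φ (σ τ) - φ * τ * oneFunctional (σ τ) = _
    ring
  rw [h1, pairing, curvePoint]
  simp only [map_smul, smul_eq_mul]
  field_simp
  ring

/-- The defining inequality holds integrand by integrand, as $\sigma(\tau)$ lies in the unit ball.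
-/
theorem curvePoint_mem {σ : ℝ → Linf} (hσ : StronglyMeasurable σ) (hσ1 : ∀ τ, ‖σ τ‖ ≤ 1) :
    curvePoint σ ∈ limitReachableSet := by
  intro Ψ φ
  rw [pairing_curvePoint hσ hσ1]
  refine mul_le_mul_of_nonneg_left ?_ (by positivity)
  refine intervalIntegral.integral_mono_on zero_le_one (integrable_curve_pairing hσ hσ1 _ φ)
    ((continuous_integral_abs_sub Ψ φ).intervalIntegrable _ _) fun τ _ => ?_
  exact ofLOne_sub_smul_apply_le Ψ (φ * τ) (hσ1 τ)

theorem continuous_dualNorm (Φ : StrongDual ℝ Linf) (φ : ℝ) :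
    Continuous fun τ : ℝ => ‖Φ - (φ * τ) • oneFunctional‖ := by fun_prop

theorem exists_mem_le_pairing (Φ : StrongDual ℝ Linf) (φ : ℝ) {ε : ℝ} (hε : 0 < ε) :
    ∃ p ∈ limitReachableSet,
      1 / (2 * π) * (∫ τ in (0 : ℝ)..1, ‖Φ - (φ * τ) • oneFunctional‖) - ε ≤
        pairing p (Φ, φ) := by
  obtain ⟨σ, hσ, hσ1, h⟩ := exists_stronglyMeasurable_norming Φ (φ • oneFunctional)
    (mul_pos Real.two_pi_pos hε)
  refine ⟨curvePoint σ, curvePoint_mem hσ hσ1, ?_⟩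
  rw [pairing_curvePoint hσ hσ1]
  have hint : (∫ τ in (0 : ℝ)..1, ‖Φ - (φ * τ) • oneFunctional‖) - 2 * π * ε ≤
      ∫ τ in (0 : ℝ)..1, (Φ - (φ * τ) • oneFunctional) (σ τ) := by
    have hc := (continuous_dualNorm Φ φ).intervalIntegrable (μ := volume) 0 1
    calc _ = ∫ τ in (0 : ℝ)..1, (‖Φ - (φ * τ) • oneFunctional‖ - 2 * π * ε) := by
          rw [intervalIntegral.integral_sub hc intervalIntegrable_const]
          simp
      _ ≤ _ := by
          refine intervalIntegral.integral_mono_on zero_le_one (hc.sub intervalIntegrable_const)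
            (integrable_curve_pairing hσ hσ1 Φ φ) fun τ _ => ?_
          have := h τ
          rwa [smul_smul, mul_comm τ φ] at this
  calc _ = 1 / (2 * π) *
        ((∫ τ in (0 : ℝ)..1, ‖Φ - (φ * τ) • oneFunctional‖) - 2 * π * ε) := by
        field_simp
    _ ≤ _ := by gcongr

/-! ### Upper bound: the pairing of points of $D_\infty$ with arbitrary functionals. -/

section UpperBound

theorem neg_mem_limitReachableSet {p : Linf × ℝ} (hp : p ∈ limitReachableSet) :
    -p ∈ limitReachableSet := by
  intro Ψ φ
  have h := hp (-Ψ) (-φ)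
  have h1 : pairing (-p) (ofLOne Ψ, φ) = pairing p (ofLOne (-Ψ), -φ) := by
    simp [pairing, ofLOne]
  rw [h1]
  refine h.trans_eq ?_
  congr 1
  refine intervalIntegral.integral_congr fun τ _ => integral_congr_ae ?_
  filter_upwards [Lp.coeFn_neg Ψ] with x hx
  rw [hx, Pi.neg_apply, ← abs_neg]
  congr 1
  ring

theorem ae_two_pi_mul_le_one {p : Linf × ℝ} (hp : p ∈ limitReachableSet) :
    ∀ᵐ x, 2 * π * p.1 x ≤ 1 := by
  -- Testing with $\Psi=(2\pi F-1)^+$ and $\phi=0$: the function $2\pi F\Psi-\Psi$ is nonnegative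
  -- with integral at most $0$, so it vanishes a.e., which forces $\Psi=0$.
  obtain ⟨G, hG⟩ := exists_comp_ae_eq p.1 (g := fun y => max (2 * π * y - 1) 0) (by fun_prop)
  obtain ⟨Ψ, hΨ⟩ := exists_lOne_ae_eq G
  have h := hp Ψ 0
  simp only [pairing, mul_zero, add_zero, zero_mul, sub_zero, ofLOne_apply,
    intervalIntegral.integral_const, one_smul] at h
  have hΨ' : ∀ᵐ x, Ψ x = max (2 * π * p.1 x - 1) 0 := by
    filter_upwards [hΨ, hG] with x h1 h2
    rw [h1, h2]
  have hint1 : Integrable (fun x => Ψ x * p.1 x) volume := by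
    refine (integrable_linf (G • p.1 : Linf)).congr ?_
    filter_upwards [mul_ae G p.1, hΨ] with x h1 h2
    rw [h1, h2]
  have hint2 : Integrable (fun x => |Ψ x|) volume := (L1.integrable_coeFn Ψ).abs
  have hle : ∫ x, (2 * π * (Ψ x * p.1 x) - |Ψ x|) ≤ 0 := by
    rw [integral_sub (hint1.const_mul _) hint2, integral_const_mul]
    rw [one_div, inv_mul_eq_div, le_div_iff₀ Real.two_pi_pos] at h
    linarith
  have hnn : 0 ≤ᵐ[volume] fun x => 2 * π * (Ψ x * p.1 x) - |Ψ x| := by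
    filter_upwards [hΨ'] with x hx
    simp only [Pi.zero_apply]
    rw [hx, abs_of_nonneg (le_max_right _ _)]
    rcases le_total (2 * π * p.1 x - 1) 0 with h1 | h1
    · simp [max_eq_right h1]
    · rw [max_eq_left h1]
      nlinarith
  have hz := (integral_eq_zero_iff_of_nonneg_ae hnn ((hint1.const_mul _).sub hint2)).mp
    (le_antisymm hle (integral_nonneg_of_ae hnn))
  filter_upwards [hz, hΨ'] with x h1 h2
  change 2 * π * (Ψ x * p.1 x) - |Ψ x| = 0 at h1
  rw [h2, abs_of_nonneg (le_max_right _ _)] at h1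
  by_contra! hlt
  rw [max_eq_left (by linarith)] at h1
  nlinarith

theorem ae_abs_two_pi_mul_le_one {p : Linf × ℝ} (hp : p ∈ limitReachableSet) :
    ∀ᵐ x, |2 * π * p.1 x| ≤ 1 := by
  filter_upwards [ae_two_pi_mul_le_one hp, ae_two_pi_mul_le_one (neg_mem_limitReachableSet hp),
    Lp.coeFn_neg p.1] with x h1 h2 h3
  rw [Prod.fst_neg, h3, Pi.neg_apply] at h2
  rw [abs_le]
  constructor <;> linarith

theorem integral_abs_sub_of_mem_Icc {α : ℝ} (hα : α ∈ Icc (0 : ℝ) 1) :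
    ∫ τ in (0 : ℝ)..1, |α - τ| = α ^ 2 - α + 1 / 2 := by
  have hc : Continuous fun τ : ℝ => |α - τ| := by fun_prop
  rw [← intervalIntegral.integral_add_adjacent_intervals (hc.intervalIntegrable 0 α)
    (hc.intervalIntegrable α 1)]
  have h1 : ∫ τ in (0 : ℝ)..α, |α - τ| = ∫ τ in (0 : ℝ)..α, (α - τ) := by
    refine intervalIntegral.integral_congr fun τ hτ => ?_
    rw [uIcc_of_le hα.1] at hτ
    exact abs_of_nonneg (sub_nonneg.mpr hτ.2)
  have h2 : ∫ τ in α..(1 : ℝ), |α - τ| = ∫ τ in α..(1 : ℝ), (τ - α) := by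
    refine intervalIntegral.integral_congr fun τ hτ => ?_
    rw [uIcc_of_le hα.2] at hτ
    rw [abs_sub_comm]
    exact abs_of_nonneg (sub_nonneg.mpr hτ.1)
  rw [h1, h2, intervalIntegral.integral_sub (by simp) (by simp),
    intervalIntegral.integral_sub (by simp) (by simp)]
  simp
  ring

theorem integral_integral_abs_sub {a : Linf} (ha : ∀ᵐ x, a x ∈ Icc (0 : ℝ) 1) :
    ∫ τ in (0 : ℝ)..1, ∫ x, |a x - τ| = ∫ x, (a x ^ 2 - a x + 1 / 2) := by
  have hτ : Integrable (fun τ : ℝ => τ) (volume.restrict (Ioc 0 1)) :=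
    (continuous_id.intervalIntegrable (μ := volume) 0 1).1
  have hint : Integrable (Function.uncurry fun (τ : ℝ) (x : Circ) => |a x - τ|)
      ((volume.restrict (Ioc 0 1)).prod volume) :=
    (((integrable_linf a).comp_snd _).sub (hτ.comp_fst _)).abs
  rw [intervalIntegral.integral_of_le zero_le_one, integral_integral_swap hint]
  refine integral_congr_ae ?_
  filter_upwards [ha] with x hx
  rw [← intervalIntegral.integral_of_le zero_le_one, integral_abs_sub_of_mem_Icc hx]

/-- Adds the integration-by-parts bound `hcurve` along $\omega$ to the bound `htest` on $f\phi$; the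
identity `hbal` cancels the remaining terms. The sign of $\phi$ serves to pull it out of $|\phi
a-\phi\tau|$. -/
theorem pairing_le_of_nonneg {p : Linf × ℝ} (hp : p ∈ limitReachableSet)
    (Φ : StrongDual ℝ Linf) {φ : ℝ} (hφ : 0 ≤ φ) :
    pairing p (Φ, φ) ≤ 1 / (2 * π) * ∫ τ in (0 : ℝ)..1, ‖Φ - (φ * τ) • oneFunctional‖ := by
  set u : Linf := (2 * π) • p.1 with hu
  set a : Linf := (1 / 2 : ℝ) • (oneLinf + u)
  have hux : ∀ᵐ x, u x = 2 * π * p.1 x := Lp.coeFn_smul _ _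
  have hax : ∀ᵐ x, a x = (1 + u x) / 2 := by
    filter_upwards [Lp.coeFn_smul (1 / 2 : ℝ) (oneLinf + u), Lp.coeFn_add oneLinf u,
      oneLinf_ae] with x h1 h2 h3
    rw [h1, Pi.smul_apply, h2, Pi.add_apply, h3, smul_eq_mul]
    ring
  have haI : ∀ᵐ x, a x ∈ Icc (0 : ℝ) 1 := by
    filter_upwards [hax, hux, ae_abs_two_pi_mul_le_one hp] with x h1 h2 h3
    rw [← h2, abs_le] at h3
    rw [h1]
    constructor <;> linarith
  let ω : ℝ → Linf := fun t => a - |a - t • oneLinf|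
  have hωx : ∀ t, ∀ᵐ x, ω t x = a x - |a x - t| := by
    intro t
    filter_upwards [Lp.coeFn_sub a |a - t • oneLinf|, Lp.coeFn_abs (a - t • oneLinf),
      Lp.coeFn_sub a (t • oneLinf), Lp.coeFn_smul t oneLinf, oneLinf_ae] with x h1 h2 h3 h4 h5
    rw [h1, Pi.sub_apply, h2, h3, Pi.sub_apply, h4, Pi.smul_apply, h5, smul_eq_mul, mul_one]
  have hω : ∀ s t, ‖ω t - ω s‖ ≤ |t - s| := by
    intro s t
    refine norm_le_of_ae_abs_le (abs_nonneg _) ?_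
    filter_upwards [Lp.coeFn_sub (ω t) (ω s), hωx t, hωx s] with x h1 h2 h3
    rw [h1, Pi.sub_apply, h2, h3]
    have h4 := abs_abs_sub_abs_le_abs_sub (a x - s) (a x - t)
    rwa [show a x - |a x - t| - (a x - |a x - s|) = |a x - s| - |a x - t| by ring,
      show t - s = a x - s - (a x - t) by ring]
  have hω0 : ω 0 = 0 := by
    apply Lp.ext
    filter_upwards [hωx 0, haI, Lp.coeFn_zero ℝ ∞ (volume : Measure Circ)] with x h1 h2 h3
    rw [h1, h3, sub_zero, abs_of_nonneg h2.1, sub_self, Pi.zero_apply]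
  have hω1 : ω 1 = u := by
    apply Lp.ext
    filter_upwards [hωx 1, haI, hax] with x h1 h2 h3
    rw [h1, abs_of_nonpos (by linarith [h2.2]), h3]
    ring
  have hone : ∀ s, oneFunctional (ω s) = (∫ x, a x) - ∫ x, |a x - s| := by
    intro s
    have hi : Integrable (fun x => |a x - s|) volume :=
      ((integrable_linf a).sub (integrable_const s)).abs
    rw [oneFunctional_apply, integral_congr_ae (hωx s), integral_sub (integrable_linf a) hi]
  obtain ⟨A, hA⟩ := exists_lOne_ae_eq a
  have hJc : Continuous fun s : ℝ => ∫ x, |a x - s| := by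
    refine (continuous_integral_abs_sub A 1).congr fun s => integral_congr_ae ?_
    filter_upwards [hA] with x hx
    rw [hx, one_mul]
  set J : ℝ := ∫ τ in (0 : ℝ)..1, ∫ x, |a x - τ| with hJ
  have hcurve := sub_add_integral_le_integral_norm Φ (φ • oneFunctional) hω
  have hΛint : ∫ s in (0 : ℝ)..1, (φ • oneFunctional) (ω s) = φ * ((∫ x, a x) - J) := by
    simp only [smul_apply, smul_eq_mul, hone]
    rw [intervalIntegral.integral_const_mul, intervalIntegral.integral_sub
      intervalIntegrable_const (hJc.intervalIntegrable _ _)]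
    simp [hJ]
  rw [hω0, hω1, hΛint, map_zero, sub_zero, smul_apply, smul_eq_mul, oneFunctional_apply] at hcurve
  have hN : ∫ τ in (0 : ℝ)..1, ‖Φ - τ • φ • oneFunctional‖ =
      ∫ τ in (0 : ℝ)..1, ‖Φ - (φ * τ) • oneFunctional‖ := by
    simp only [smul_smul, mul_comm]
  rw [hN] at hcurve
  -- For this test function, $\operatorname{sign}(\phi a-\phi\tau)$ is, when $\phi>0$, the formal
  -- velocity of $\omega$, so no slack arises against `hcurve`.
  have htest := hp (φ • A) φ
  have hlhs : pairing p (ofLOne (φ • A), φ) =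
      φ * (∫ x, a x * p.1 x) + 2 * π * p.2 * φ := by
    have : ofLOne (φ • A) p.1 = φ * ofLOne A p.1 := by simp [ofLOne]
    simp only [pairing, this, ofLOne_apply]
    congr 2
    refine integral_congr_ae ?_
    filter_upwards [hA] with x hx
    rw [hx]
  have hrhs : ∫ τ in (0 : ℝ)..1, ∫ x : Circ, |(φ • A : LOne) x - φ * τ| = φ * J := by
    rw [hJ, ← intervalIntegral.integral_const_mul]
    refine intervalIntegral.integral_congr fun τ _ => ?_
    change ∫ x : Circ, |(φ • A : LOne) x - φ * τ| = φ * ∫ x : Circ, |a x - τ|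
    rw [← integral_const_mul]
    refine integral_congr_ae ?_
    filter_upwards [hA, Lp.coeFn_smul φ A] with x h1 h2
    rw [h2, Pi.smul_apply, h1, smul_eq_mul, ← mul_sub, abs_mul, abs_of_nonneg hφ]
  rw [hlhs, hrhs] at htest
  have hsq : Integrable (fun x => a x ^ 2) volume := by
    refine (integrable_linf (a • a : Linf)).congr ?_
    filter_upwards [mul_ae a a] with x hx
    rw [hx, sq]
  have hJeq : J = ∫ x, (a x ^ 2 - a x + 1 / 2) := integral_integral_abs_sub haI
  have hpau : 2 * π * ∫ x, a x * p.1 x = ∫ x, (2 * a x ^ 2 - a x) := by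
    rw [← integral_const_mul]
    refine integral_congr_ae ?_
    filter_upwards [hax, hux] with x h1 h2
    have : u x = 2 * a x - 1 := by linarith
    rw [h2] at this
    linear_combination a x * this
  -- With $u=2a-1$ both integrands equal $2a^2-2a+1$.
  have hbal : 2 * J = (2 * π * ∫ x, a x * p.1 x) - (∫ x, u x) + ∫ x, a x := by
    have hi : Integrable (fun x => 2 * a x ^ 2 - a x) volume :=
      (hsq.const_mul 2).sub (integrable_linf a)
    have hi' : Integrable (fun x => 2 * a x ^ 2 - a x - u x) volume := hi.sub (integrable_linf u)
    rw [hJeq, hpau, ← integral_sub hi (integrable_linf u), ← integral_add hi' (integrable_linf a),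
      ← integral_const_mul]
    refine integral_congr_ae ?_
    filter_upwards [hax] with x h1
    have : u x = 2 * a x - 1 := by linarith
    rw [this]
    ring
  have hΦu : Φ u = 2 * π * Φ p.1 := by rw [hu, map_smul, smul_eq_mul]
  rw [one_div, inv_mul_eq_div, le_div_iff₀ Real.two_pi_pos] at htest ⊢
  have hbalφ : φ * (2 * J) = φ * ((2 * π * ∫ x, a x * p.1 x) - (∫ x, u x) + ∫ x, a x) := by
    rw [hbal]
  simp only [pairing]
  linarith

theorem pairing_le {p : Linf × ℝ} (hp : p ∈ limitReachableSet) (Φ : StrongDual ℝ Linf) (φ : ℝ) :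
    pairing p (Φ, φ) ≤ 1 / (2 * π) * ∫ τ in (0 : ℝ)..1, ‖Φ - (φ * τ) • oneFunctional‖ := by
  rcases le_total 0 φ with hφ | hφ
  · exact pairing_le_of_nonneg hp Φ hφ
  · have h := pairing_le_of_nonneg (neg_mem_limitReachableSet hp) (-Φ) (neg_nonneg.mpr hφ)
    have h1 : pairing (-p) (-Φ, -φ) = pairing p (Φ, φ) := by simp [pairing]
    rw [h1] at h
    refine h.trans_eq ?_
    congr 1
    refine intervalIntegral.integral_congr fun τ _ => ?_
    rw [← norm_neg]
    congr 1
    module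

end UpperBound

/-- The support function of the limit reachable set, in terms of dual norms. -/
theorem supportFunction_eq (Φ : StrongDual ℝ Linf) (φ : ℝ) :
    supportFunction limitReachableSet (Φ, φ) =
      ((1 / (2 * π) * ∫ τ in (0 : ℝ)..1, ‖Φ - (φ * τ) • oneFunctional‖ : ℝ) : EReal) := by
  apply le_antisymm
  · exact iSup₂_le fun p hp => EReal.coe_le_coe_iff.mpr (pairing_le hp Φ φ)
  · refine EReal.ge_of_forall_gt_iff_ge.mp fun r hr => ?_
    rw [EReal.coe_lt_coe_iff] at hr
    obtain ⟨p, hp, h⟩ := exists_mem_le_pairing Φ φ (sub_pos.mpr hr)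
    rw [sub_sub_cancel] at h
    exact (EReal.coe_le_coe_iff.mpr h).trans
      (le_iSup₂_of_le (f := fun p _ => ((pairing p (Φ, φ) : ℝ) : EReal)) p hp le_rfl)

/-! ### Transport to measures on the spectrum. -/

/-- A functional on `C(𝔛, ℝ)` transported from `L_∞`. -/
def gelfandDual (Φ : StrongDual ℝ Linf) : StrongDual ℝ C(GelfandSpectrum, ℝ) :=
  Φ.comp gelfandEquiv.symm.toContinuousLinearEquiv.toContinuousLinearMap

theorem gelfandDual_apply (Φ : StrongDual ℝ Linf) (F : Linf) :
    gelfandDual Φ (gelfandEquiv F) = Φ F :=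
  congrArg Φ (gelfandEquiv.symm_apply_apply F)

theorem norm_gelfandDual (Φ : StrongDual ℝ Linf) : ‖gelfandDual Φ‖ = ‖Φ‖ :=
  ContinuousLinearMap.opNorm_comp_linearIsometryEquiv Φ gelfandEquiv.symm

theorem isGelfandMeasure_iff (Φ : StrongDual ℝ Linf) (m : SignedMeasure GelfandSpectrum) :
    IsGelfandMeasure Φ m ↔ m.totalVariation.Regular ∧
      ∀ f : C(GelfandSpectrum, ℝ), ∫ᵛ χ, f χ ∂•m = gelfandDual Φ f := by
  refine and_congr_right fun _ => ⟨fun h f => ?_, fun h F => ?_⟩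
  · obtain ⟨F, rfl⟩ := gelfandEquiv.surjective f
    rw [gelfandDual_apply, ← h F]
    rfl
  · rw [← gelfandDual_apply, ← h]
    rfl

theorem existsUnique_isGelfandMeasure (Φ : StrongDual ℝ Linf) :
    ∃! m : SignedMeasure GelfandSpectrum, IsGelfandMeasure Φ m := by
  obtain ⟨m, hm⟩ := exists_regular_signedMeasure (gelfandDual Φ)
  refine ⟨m, (isGelfandMeasure_iff Φ m).mpr hm, fun n hn => ?_⟩
  replace hn := (isGelfandMeasure_iff Φ n).mp hn
  exact signedMeasure_ext hn.1 hm.1 fun f => by rw [hn.2, hm.2]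

theorem isGelfandMeasure_gelfandMeasure (Φ : StrongDual ℝ Linf) :
    IsGelfandMeasure Φ (gelfandMeasure Φ) :=
  Classical.epsilon_spec (existsUnique_isGelfandMeasure Φ).exists

theorem IsGelfandMeasure.mass_eq {Φ : StrongDual ℝ Linf} {m : SignedMeasure GelfandSpectrum}
    (hm : IsGelfandMeasure Φ m) : mass m = ‖Φ‖ := by
  rw [isGelfandMeasure_iff] at hm
  rw [← norm_gelfandDual]
  exact totalVariation_real_univ_eq_norm hm.1 hm.2

theorem IsGelfandMeasure.sub_smul {Φ Λ : StrongDual ℝ Linf}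
    {m n : SignedMeasure GelfandSpectrum} (hm : IsGelfandMeasure Φ m)
    (hn : IsGelfandMeasure Λ n) (c : ℝ) : IsGelfandMeasure (Φ - c • Λ) (m - c • n) := by
  have := hm.1
  have := hn.1
  constructor
  -- Uniqueness applies only to regular measures, so the combination must be shown regular;
  -- domination by a finite regular measure suffices.
  · have hle : (m - c • n).totalVariation ≤ m.totalVariation + ‖c‖₊ • n.totalVariation := by
      simp only [SignedMeasure.totalVariation_eq_variation]
      refine VectorMeasure.variation_sub_le.trans ?_
      rw [VectorMeasure.variation_smul]
    exact regular_of_le hle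
  · intro F
    have h1 : m.Integrable (gelfand F) := integrable_variation m (gelfandEquiv F)
    have h2 : n.Integrable (gelfand F) := integrable_variation n (gelfandEquiv F)
    have h3 := VectorMeasure.integral_sub_vectorMeasure
      (B := ContinuousLinearMap.lsmul ℝ ℝ) h1 (h2.smul_vectorMeasure c)
    refine h3.trans ?_
    rw [VectorMeasure.integral_smul_vectorMeasure]
    exact congrArg₂ (fun r s => r - c • s) (hm.2 F) (hn.2 F)

theorem mass_gelfandMeasure_sub (Φ : StrongDual ℝ Linf) (c : ℝ) :
    mass (gelfandMeasure Φ - c • gelfandMeasure oneFunctional) = ‖Φ - c • oneFunctional‖ :=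
  ((isGelfandMeasure_gelfandMeasure Φ).sub_smul
    (isGelfandMeasure_gelfandMeasure oneFunctional) c).mass_eq

end LimitSet
end

open LimitSet
theorem mainTheorem9 :
    (∀ Φ : StrongDual ℝ Linf, ∃! m : SignedMeasure GelfandSpectrum, IsGelfandMeasure Φ m) ∧
    ∀ (Φ : StrongDual ℝ Linf) (φ : ℝ),
      IntervalIntegrable
        (fun τ : ℝ => mass (gelfandMeasure Φ - (φ * τ) • gelfandMeasure oneFunctional))
        volume 0 1 ∧
      supportFunction limitReachableSet (Φ, φ) =
        ((1 / (2 * Real.pi) * ∫ τ in (0 : ℝ)..1,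
          mass (gelfandMeasure Φ - (φ * τ) • gelfandMeasure oneFunctional) : ℝ) : EReal) := by
  refine ⟨existsUnique_isGelfandMeasure, fun Φ φ => ?_⟩
  simp only [mass_gelfandMeasure_sub]
  exact ⟨(continuous_dualNorm Φ φ).intervalIntegrable 0 1, supportFunction_eq Φ φ⟩
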